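/- Let $\mathcal H\neq\{0\}$ and $\mathcal K$ be complex Hilbert spaces, let $\mathcal H\otimes\mathcal K$ be their Hilbert space tensor product, and let $U$ be a unitary operator on $\mathcal H\otimes\mathcal K$. For $f,g\in\mathcal H$ and a bounded operator $Y$ on $\mathcal H\otimes\mathcal K$, let $Y(f,g)=\mathrm{Tr}_{|g\rangle\langle f|}[Y]$ be the bounded operator on $\mathcal K$ determined by $\langle\varphi,Y(f,g)\psi\rangle=\langle f\otimes\varphi,Y(g\otimes\psi)\rangle$ for all $\varphi,\psi\in\mathcal K$. Write $U^*(f,g)$ for $Y(f,g)$ with $Y=U^*$. The Environment Right-Action Algebra of $U$ is the von Neumann algebra on $\mathcal K$ given by the bicommutant $$\mathcal A_r(U)=\{U^*(f_1,g_1)\,U(f_2,g_2)\;:\; f_1,g_1,f_2,g_2\in\mathcal H\}''.$$ For a unit vector $\psi\in\mathcal K$, let $U_\psi:\mathcal H\to\mathcal H\otimes\mathcal K$ be the map $f\mapsto U(f\otimes\psi)$, and let $\mathcal L_{|\psi\rangle\langle\psi|}(X)=\mathrm{Tr}_{|\psi\rangle\langle\psi|}[U^*(X\otimes I)U]$ for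 $X\in\mathcal B(\mathcal H)$, where $\langle f,\mathrm{Tr}_{|\psi\rangle\langle\psi|}[Y]g\rangle=\langle f\otimes\psi,Y(g\otimes\psi)\rangle$ for all $f,g\in\mathcal H$. A Stinespring representation $(\mathcal H\otimes\mathcal K,V)$ of a normal completely positive map $\mathcal L$ on $\mathcal B(\mathcal H)$ consists of an isometry $V:\mathcal H\to\mathcal H\otimes\mathcal K$ with $\mathcal L(X)=V^*(X\otimes I)V$ for all $X\in\mathcal B(\mathcal H)$; it is minimal if the linear span of $\{(X\otimes I)Vf: X\in\mathcal B(\mathcal H),\ f\in\mathcal H\}$ is dense in $\mathcal H\otimes\mathcal K$. If for every unit vector $\psi\in\mathcal K$ the pair $(\mathcal H\otimes\mathcal K,U_\psi)$ is a minimal Stinespring representation of $\mathcal L_{|\psi\rangle\langle\psi|}$, then $\mathcal A_r(U)=\mathcal B(\mathcal K)$. -/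

import Mathlib

open scoped TensorProduct InnerProductSpace

noncomputable section

namespace EnvAction

/-- The Hilbert space tensor product `H ⊗ K`: the completion of the algebraic tensor product for
the inner product determined by `⟪f ⊗ φ, g ⊗ ψ⟫ = ⟪f, g⟫ ⟪φ, ψ⟫`. -/
abbrev HilbertTensor (H K : Type*) [NormedAddCommGroup H] [InnerProductSpace ℂ H]
    [NormedAddCommGroup K] [InnerProductSpace ℂ K] : Type _ :=
  UniformSpace.Completion (H ⊗[ℂ] K)

section

variable {H K : Type*} [NormedAddCommGroup H] [InnerProductSpace ℂ H]
  [NormedAddCommGroup K] [InnerProductSpace ℂ K]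

/-- The elementary tensor `f ⊗ ψ` in the Hilbert space tensor product. -/
def pureTensor (f : H) (ψ : K) : HilbertTensor H K :=
  ((f ⊗ₜ[ℂ] ψ : H ⊗[ℂ] K) : UniformSpace.Completion (H ⊗[ℂ] K))

/-- The bounded operator `K → H ⊗ K`, `φ ↦ f ⊗ φ`. -/
def tensorLeft (f : H) : K →L[ℂ] HilbertTensor H K :=
  (UniformSpace.Completion.toComplL : (H ⊗[ℂ] K) →L[ℂ] HilbertTensor H K) ∘L
    TensorProduct.mkL ℂ H K f

/-- The bounded operator `H → H ⊗ K`, `f ↦ f ⊗ ψ`. -/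
def tensorRight (ψ : K) : H →L[ℂ] HilbertTensor H K :=
  (UniformSpace.Completion.toComplL : (H ⊗[ℂ] K) →L[ℂ] HilbertTensor H K) ∘L
    (TensorProduct.mkL ℂ H K).flip ψ

theorem tensorLeft_apply (f : H) (φ : K) : tensorLeft f φ = pureTensor f φ := rfl

theorem tensorRight_apply (ψ : K) (f : H) : tensorRight ψ f = pureTensor f ψ := rfl

theorem inner_pureTensor (f g : H) (φ ψ : K) :
    ⟪pureTensor f φ, pureTensor g ψ⟫_ℂ = ⟪f, g⟫_ℂ * ⟪φ, ψ⟫_ℂ := by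
  simp [pureTensor]

/-- The bounded operator `X ⊗ I` on `H ⊗ K`, for `X` a bounded operator on `H`. -/
def ampliation (K : Type*) [NormedAddCommGroup K] [InnerProductSpace ℂ K] (X : H →L[ℂ] H) :
    HilbertTensor H K →L[ℂ] HilbertTensor H K :=
  (X.rTensor K).completion

theorem ampliation_pureTensor (X : H →L[ℂ] H) (f : H) (ψ : K) :
    ampliation K X (pureTensor f ψ) = pureTensor (X f) ψ := by
  simp [ampliation, pureTensor]

section

variable [CompleteSpace H]

/-- The partial trace `Tr_{|ψ⟩⟨φ|}[Y]` over `K`, a bounded operator on `H`. It is the operator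
with `⟪f, Tr_{|ψ⟩⟨φ|}[Y] g⟫ = Tr[(|g⟩⟨f| ⊗ |ψ⟩⟨φ|) Y] = ⟪f ⊗ φ, Y (g ⊗ ψ)⟫`. -/
def sysPartialTrace (ψ φ : K) (Y : HilbertTensor H K →L[ℂ] HilbertTensor H K) : H →L[ℂ] H :=
  ContinuousLinearMap.adjoint (tensorRight φ) ∘L Y ∘L tensorRight ψ

theorem inner_sysPartialTrace (ψ φ : K) (Y : HilbertTensor H K →L[ℂ] HilbertTensor H K)
    (f g : H) :
    ⟪f, sysPartialTrace ψ φ Y g⟫_ℂ = ⟪pureTensor f φ, Y (pureTensor g ψ)⟫_ℂ := by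
  simp [sysPartialTrace, ContinuousLinearMap.adjoint_inner_right, tensorRight_apply]

end

variable [CompleteSpace K]

/-- The partial trace `Y(f, g) = Tr_{|g⟩⟨f|}[Y]` over `H`, a bounded operator on `K`. It is the
operator with `⟪φ, Y(f, g) ψ⟫ = Tr[(|g⟩⟨f| ⊗ |ψ⟩⟨φ|) Y] = ⟪f ⊗ φ, Y (g ⊗ ψ)⟫`. -/
def envPartialTrace (Y : HilbertTensor H K →L[ℂ] HilbertTensor H K) (f g : H) : K →L[ℂ] K :=
  ContinuousLinearMap.adjoint (tensorLeft f) ∘L Y ∘L tensorLeft g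

theorem inner_envPartialTrace (Y : HilbertTensor H K →L[ℂ] HilbertTensor H K) (f g : H)
    (φ ψ : K) :
    ⟪φ, envPartialTrace Y f g ψ⟫_ℂ = ⟪pureTensor f φ, Y (pureTensor g ψ)⟫_ℂ := by
  simp [envPartialTrace, ContinuousLinearMap.adjoint_inner_right, tensorLeft_apply]

/-- The products `U*(f₁, g₁) U(f₂, g₂)`, with `f₁, g₁, f₂, g₂` in `H`. -/
def rightActionGenerators (U : HilbertTensor H K →L[ℂ] HilbertTensor H K) : Set (K →L[ℂ] K) :=
  {A | ∃ f₁ g₁ f₂ g₂ : H,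
    A = envPartialTrace (ContinuousLinearMap.adjoint U) f₁ g₁ ∘L envPartialTrace U f₂ g₂}

theorem star_envPartialTrace (Y : HilbertTensor H K →L[ℂ] HilbertTensor H K) (f g : H) :
    star (envPartialTrace Y f g) = envPartialTrace (ContinuousLinearMap.adjoint Y) g f := by
  simp only [envPartialTrace, ContinuousLinearMap.star_eq_adjoint,
    ContinuousLinearMap.adjoint_comp, ContinuousLinearMap.adjoint_adjoint]
  rfl

theorem star_rightActionGenerators (U : HilbertTensor H K →L[ℂ] HilbertTensor H K) :
    star (rightActionGenerators U) = rightActionGenerators U := by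
  have key : ∀ A ∈ rightActionGenerators U, star A ∈ rightActionGenerators U := by
    rintro _ ⟨f₁, g₁, f₂, g₂, rfl⟩
    exact ⟨g₂, f₂, g₁, f₁, by
      rw [← ContinuousLinearMap.mul_def, star_mul, ContinuousLinearMap.mul_def,
        star_envPartialTrace, star_envPartialTrace,
        ContinuousLinearMap.adjoint_adjoint]⟩
  ext A
  exact ⟨fun h => by simpa using key _ h, fun h => key _ h⟩

theorem star_mem_centralizer_of_star_eq {S : Set (K →L[ℂ] K)} (hS : star S = S)
    {A : K →L[ℂ] K} (hA : A ∈ Set.centralizer S) : star A ∈ Set.centralizer S := by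
  intro B hB
  have hB' : star B ∈ S := by
    rw [← hS]
    simpa using hB
  simpa using (congrArg star (hA (star B) hB')).symm

theorem star_centralizer_of_star_eq {S : Set (K →L[ℂ] K)} (hS : star S = S) :
    star (Set.centralizer S) = Set.centralizer S := by
  ext A
  exact ⟨fun h => by simpa using star_mem_centralizer_of_star_eq hS h,
    fun h => star_mem_centralizer_of_star_eq hS h⟩

/-- The Environment Right-Action Algebra of `U`: the von Neumann algebra on `K` whose underlying
set is the bicommutant of the operators `U*(f₁, g₁) U(f₂, g₂)`. -/
def rightActionAlgebra (U : HilbertTensor H K →L[ℂ] HilbertTensor H K) : VonNeumannAlgebra K where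
  toStarSubalgebra :=
    { Subalgebra.centralizer ℂ (Set.centralizer (rightActionGenerators U)) with
      star_mem' := fun hA => star_mem_centralizer_of_star_eq
        (star_centralizer_of_star_eq (star_rightActionGenerators U)) hA }
  centralizer_centralizer' :=
    Set.centralizer_centralizer_centralizer (Set.centralizer (rightActionGenerators U))

theorem coe_rightActionAlgebra (U : HilbertTensor H K →L[ℂ] HilbertTensor H K) :
    (rightActionAlgebra U : Set (K →L[ℂ] K)) =
      Set.centralizer (Set.centralizer (rightActionGenerators U)) := rfl

/-- The operator `U_ψ : H → H ⊗ K`, `f ↦ U (f ⊗ ψ)`. -/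
def dilation (U : HilbertTensor H K →L[ℂ] HilbertTensor H K) (ψ : K) :
    H →L[ℂ] HilbertTensor H K :=
  U ∘L tensorRight ψ

variable [CompleteSpace H]

/-- The map `L_{|ψ⟩⟨ψ|} : X ↦ Tr_{|ψ⟩⟨ψ|}[U* (X ⊗ I) U]` on the bounded operators on `H`. -/
def reducedMap (U : HilbertTensor H K →L[ℂ] HilbertTensor H K) (ψ : K) (X : H →L[ℂ] H) :
    H →L[ℂ] H :=
  sysPartialTrace ψ ψ (ContinuousLinearMap.adjoint U ∘L ampliation K X ∘L U)

/-- `(H ⊗ K, V)` is a Stinespring representation of `L`: `V` is an isometry from `H` to `H ⊗ K`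
and `L X = V* (X ⊗ I) V` for every `X`. Every map `L` of this form is normal and completely
positive, so these properties of `L` are not repeated. -/
def IsStinespring (L : (H →L[ℂ] H) → (H →L[ℂ] H)) (V : H →L[ℂ] HilbertTensor H K) : Prop :=
  Isometry V ∧
    ∀ X : H →L[ℂ] H, L X = ContinuousLinearMap.adjoint V ∘L ampliation K X ∘L V

/-- A Stinespring representation `(H ⊗ K, V)` is minimal if the set of the vectors `(X ⊗ I) V f`
is total in `H ⊗ K`. -/
def IsMinimalStinespring (L : (H →L[ℂ] H) → (H →L[ℂ] H)) (V : H →L[ℂ] HilbertTensor H K) :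
    Prop :=
  IsStinespring L V ∧
    (Submodule.span ℂ {x : HilbertTensor H K |
      ∃ (X : H →L[ℂ] H) (f : H), x = ampliation K X (V f)}).topologicalClosure = ⊤

end

end EnvAction

end

/-!
Minimality of `U_ψ` says that the vectors `U(f, g) ψ` are total in `K`, that is, that `ψ` is cyclic
for the set `𝒮` of the operators `U(f, g)`. If every nonzero vector is cyclic for `𝒮`, then every
nonzero vector is cyclic for the set `𝒮* 𝒮` of generators: if `κ` is orthogonal to `𝒮* 𝒮 χ`, then
every `A κ` with `A ∈ 𝒮` is orthogonal to `𝒮 χ`, so `𝒮 κ = 0`, and a nonzero `κ` would not be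
cyclic for `𝒮`. Two operators `B`, `C` in the commutant of the generators with `B C = 0` and
`C χ ≠ 0` satisfy `B = 0`, because `B` vanishes at the cyclic vector `C χ`. The commutant is thus a
C⋆-algebra without zero divisors; its self-adjoint elements have one-point spectra, so it consists
of the scalars.
-/

namespace EnvAction

open scoped Pointwise ComplexStarModule

section NoZeroDivisors

variable {A : Type*} [Ring A] [StarRing A] [TopologicalSpace A] [Algebra ℝ A]
  [ContinuousFunctionalCalculus ℝ A IsSelfAdjoint] [NoZeroDivisors A]

theorem spectrum_subset_Iic_or_subset_Ici_of_isSelfAdjoint {a : A} (ha : IsSelfAdjoint a)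
    (m : ℝ) :
    spectrum ℝ a ⊆ Set.Iic m ∨ spectrum ℝ a ⊆ Set.Ici m := by
  have posPart_mul_negPart_eq_zero :
      cfc (fun t : ℝ => max (t - m) 0) a * cfc (fun t : ℝ => max (m - t) 0) a = 0 := by
    rw [← cfc_mul _ _ a (by fun_prop) (by fun_prop), ← cfc_zero ℝ a]
    congr 1
    ext t
    rcases le_total t m with ht | ht <;> simp [ht]
  refine (mul_eq_zero.mp posPart_mul_negPart_eq_zero).imp
    (fun h x hx => ?_) (fun h x hx => ?_) <;>
  · rw [← cfc_zero ℝ a, cfc_eq_cfc_iff_eqOn ha (by fun_prop) (by fun_prop)] at h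
    simpa using h hx

theorem subsingleton_spectrum_of_isSelfAdjoint {a : A} (ha : IsSelfAdjoint a) :
    (spectrum ℝ a).Subsingleton := by
  have not_lt_of_mem : ∀ x ∈ spectrum ℝ a, ∀ y ∈ spectrum ℝ a, ¬ x < y := by
    intro x hx y hy hxy
    obtain ⟨m, hxm, hmy⟩ := exists_between hxy
    rcases spectrum_subset_Iic_or_subset_Ici_of_isSelfAdjoint ha m with hm | hm
    · exact hmy.not_ge (hm hy)
    · exact hxm.not_ge (hm hx)
  exact fun x hx y hy =>
    le_antisymm (not_lt.mp (not_lt_of_mem y hy x hx)) (not_lt.mp (not_lt_of_mem x hx y hy))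

theorem exists_eq_algebraMap_of_isSelfAdjoint {a : A} (ha : IsSelfAdjoint a) :
    ∃ r : ℝ, a = algebraMap ℝ A r := by
  rcases (subsingleton_spectrum_of_isSelfAdjoint ha).eq_empty_or_singleton with h | ⟨r, h⟩
  · exact ⟨0, CFC.eq_algebraMap_of_spectrum_subset_singleton a 0 (h.trans_subset (by simp))⟩
  · exact ⟨r, CFC.eq_algebraMap_of_spectrum_subset_singleton a r h.subset⟩

end NoZeroDivisors

theorem algebraMap_surjective_of_noZeroDivisors {A : Type*} [CStarAlgebra A] [NoZeroDivisors A] :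
    Function.Surjective (algebraMap ℂ A) := by
  intro a
  obtain ⟨r, hr⟩ := exists_eq_algebraMap_of_isSelfAdjoint (ℜ a).2
  obtain ⟨s, hs⟩ := exists_eq_algebraMap_of_isSelfAdjoint (ℑ a).2
  refine ⟨r + Complex.I * s, ?_⟩
  rw [← realPart_add_I_smul_imaginaryPart a, hr, hs]
  simp [Algebra.algebraMap_eq_smul_one, add_smul, mul_smul]

/-- The vector `ψ` is cyclic for the set `S` of operators: the vectors `A ψ`, `A ∈ S`, are total.
No algebra structure on `S` is assumed. -/
def IsCyclicVector {𝕜 E : Type*} [Semiring 𝕜] [AddCommMonoid E] [Module 𝕜 E] [TopologicalSpace E]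
    (S : Set (E →L[𝕜] E)) (ψ : E) : Prop :=
  Dense (Submodule.span 𝕜 ((fun A : E →L[𝕜] E => A ψ) '' S) : Set E)

section TopologicalModule

variable {𝕜 E : Type*} [Semiring 𝕜] [AddCommMonoid E] [Module 𝕜 E] [TopologicalSpace E]
  {S : Set (E →L[𝕜] E)}

theorem IsCyclicVector.of_smul {c : 𝕜} {ψ : E} (h : IsCyclicVector S (c • ψ)) :
    IsCyclicVector S ψ := by
  refine h.mono (Submodule.span_le.mpr (Set.forall_mem_image.mpr fun A hA => ?_))
  rw [map_smul]
  exact Submodule.smul_mem _ c (Submodule.subset_span (Set.mem_image_of_mem _ hA))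

variable [T2Space E]

theorem IsCyclicVector.eq_zero_of_mem_centralizer {ψ : E} (h : IsCyclicVector S ψ)
    {B : E →L[𝕜] E} (hB : B ∈ Set.centralizer S) (hψ : B ψ = 0) : B = 0 := by
  refine ContinuousLinearMap.ext_on h ?_
  rintro _ ⟨A, hA, rfl⟩
  simpa [hψ] using (DFunLike.congr_fun (hB A hA) ψ).symm

theorem eq_zero_or_eq_zero_of_mul_eq_zero_of_mem_centralizer
    (hS : ∀ ψ ≠ 0, IsCyclicVector S ψ)
    {B C : E →L[𝕜] E} (hB : B ∈ Set.centralizer S) (hBC : B * C = 0) : B = 0 ∨ C = 0 := by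
  refine or_iff_not_imp_right.mpr fun hC => ?_
  obtain ⟨χ, hχ⟩ := DFunLike.exists_ne hC
  exact (hS _ hχ).eq_zero_of_mem_centralizer hB (DFunLike.congr_fun hBC χ)

end TopologicalModule

section Hilbert

variable {𝕜 E : Type*} [RCLike 𝕜] [NormedAddCommGroup E] [InnerProductSpace 𝕜 E]

theorem dense_span_iff_forall_inner_eq_zero [CompleteSpace E] {s : Set E} :
    Dense (Submodule.span 𝕜 s : Set E) ↔ ∀ x : E, (∀ v ∈ s, ⟪x, v⟫_𝕜 = 0) → x = 0 := by
  rw [Submodule.dense_iff_topologicalClosure_eq_top, Submodule.topologicalClosure_eq_top_iff,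
    Submodule.eq_bot_iff]
  refine forall_congr' fun x => imp_congr_left ?_
  rw [← Submodule.span_singleton_le_iff_mem, ← Submodule.isOrtho_iff_le, Submodule.isOrtho_span]
  simp

variable [CompleteSpace E] {S : Set (E →L[𝕜] E)}

theorem isCyclicVector_iff_forall_inner_eq_zero {ψ : E} :
    IsCyclicVector S ψ ↔ ∀ κ : E, (∀ A ∈ S, ⟪κ, A ψ⟫_𝕜 = 0) → κ = 0 := by
  simp only [IsCyclicVector, dense_span_iff_forall_inner_eq_zero, Set.forall_mem_image]

theorem isCyclicVector_star_mul_self (hS : ∀ ψ ≠ 0, IsCyclicVector S ψ) {χ : E} (hχ : χ ≠ 0) :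
    IsCyclicVector (star S * S) χ := by
  refine isCyclicVector_iff_forall_inner_eq_zero.mpr fun κ hκ => ?_
  have apply_eq_zero : ∀ A ∈ S, A κ = 0 := by
    refine fun A hA => isCyclicVector_iff_forall_inner_eq_zero.mp (hS χ hχ) _ fun B hB => ?_
    simpa [ContinuousLinearMap.star_eq_adjoint, ContinuousLinearMap.adjoint_inner_right] using
      hκ (star A * B) (Set.mul_mem_mul (Set.star_mem_star.mpr hA) hB)
  by_contra hκ0
  refine hκ0 (isCyclicVector_iff_forall_inner_eq_zero.mp (hS κ hκ0) κ fun A hA => ?_)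
  rw [apply_eq_zero A hA, inner_zero_right]

end Hilbert

section Schur

variable {E : Type*} [NormedAddCommGroup E] [InnerProductSpace ℂ E] [CompleteSpace E]
  {S : Set (E →L[ℂ] E)}

theorem starSubalgebra_centralizer_eq_bot (hS : ∀ ψ ≠ 0, IsCyclicVector S ψ) :
    StarSubalgebra.centralizer ℂ S = ⊥ := by
  have : IsClosed (StarSubalgebra.centralizer ℂ S : Set (E →L[ℂ] E)) :=
    Set.isClosed_centralizer _
  have : NoZeroDivisors (StarSubalgebra.centralizer ℂ S) := by
    refine ⟨fun {B C} hBC => ?_⟩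
    have hB : (B : E →L[ℂ] E) ∈ Set.centralizer S :=
      Set.centralizer_subset Set.subset_union_left B.2
    simpa using
      eq_zero_or_eq_zero_of_mul_eq_zero_of_mem_centralizer hS hB (congrArg Subtype.val hBC)
  refine eq_bot_iff.mpr fun T hT => ?_
  obtain ⟨c, hc⟩ :=
    algebraMap_surjective_of_noZeroDivisors (A := StarSubalgebra.centralizer ℂ S) ⟨T, hT⟩
  exact StarSubalgebra.mem_bot.mpr ⟨c, congrArg Subtype.val hc⟩

theorem centralizer_centralizer_eq_univ (hS : ∀ ψ ≠ 0, IsCyclicVector S ψ) (hstar : star S = S) :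
    Set.centralizer (Set.centralizer S) = Set.univ := by
  have centralizer_eq_range : Set.centralizer S = Set.range (algebraMap ℂ (E →L[ℂ] E)) := by
    rw [← StarSubalgebra.coe_bot, ← starSubalgebra_centralizer_eq_bot hS,
      StarSubalgebra.coe_centralizer, hstar, Set.union_self]
  rw [centralizer_eq_range, Set.eq_univ_iff_forall]
  rintro T _ ⟨c, rfl⟩
  exact Algebra.commutes c T

end Schur

section Slices

variable {H K : Type*} [NormedAddCommGroup H] [InnerProductSpace ℂ H]
  [NormedAddCommGroup K] [InnerProductSpace ℂ K]

theorem ext_pureTensor {F : Type*} [AddCommMonoid F] [Module ℂ F] [TopologicalSpace F] [T2Space F]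
    {A B : HilbertTensor H K →L[ℂ] F}
    (h : ∀ f ψ, A (pureTensor f ψ) = B (pureTensor f ψ)) : A = B := by
  have h_coe : A.toLinearMap ∘ₗ UniformSpace.Completion.toComplL.toLinearMap =
      B.toLinearMap ∘ₗ UniformSpace.Completion.toComplL.toLinearMap := TensorProduct.ext' h
  exact DFunLike.coe_injective <|
    UniformSpace.Completion.ext A.continuous B.continuous (LinearMap.congr_fun h_coe)

theorem inner_pureTensor_ampliation [CompleteSpace H] (X : H →L[ℂ] H) (h : H) (κ : K)
    (v : HilbertTensor H K) :
    ⟪pureTensor h κ, ampliation K X v⟫_ℂ =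
      ⟪pureTensor (ContinuousLinearMap.adjoint X h) κ, v⟫_ℂ := by
  have functional_eq : innerSL ℂ (pureTensor h κ) ∘L ampliation K X =
      innerSL ℂ (pureTensor (ContinuousLinearMap.adjoint X h) κ) :=
    ext_pureTensor fun f ψ => by
      simp [ampliation_pureTensor, inner_pureTensor, ContinuousLinearMap.adjoint_inner_left]
  exact DFunLike.congr_fun functional_eq v

/-- The set of the vectors `(X ⊗ I) V f`; a Stinespring representation
`(H ⊗ K, V)` is minimal when this set is total. -/
def ampliationOrbit (V : H →L[ℂ] HilbertTensor H K) : Set (HilbertTensor H K) :=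
  {x | ∃ (X : H →L[ℂ] H) (f : H), x = ampliation K X (V f)}

variable [CompleteSpace K]

/-- The set of the slices `U(f, g) = Tr_{|g⟩⟨f|}[U]` of `U`, with `f, g` in `H`. The
generators of `A_r(U)` are the products `A* B` of slices. -/
def envSlices (U : HilbertTensor H K →L[ℂ] HilbertTensor H K) : Set (K →L[ℂ] K) :=
  {A | ∃ f g : H, A = envPartialTrace U f g}

theorem star_envSlices_mul_envSlices (U : HilbertTensor H K →L[ℂ] HilbertTensor H K) :
    star (envSlices U) * envSlices U = rightActionGenerators U := by
  ext T
  constructor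
  · rintro ⟨A, ⟨f₁, g₁, hA⟩, B, ⟨f₂, g₂, rfl⟩, rfl⟩
    refine ⟨g₁, f₁, f₂, g₂, ?_⟩
    rw [← star_envPartialTrace, ← hA, star_star]
    rfl
  · rintro ⟨f₁, g₁, f₂, g₂, rfl⟩
    rw [← star_envPartialTrace]
    exact Set.mul_mem_mul (Set.star_mem_star.mpr ⟨g₁, f₁, rfl⟩) ⟨f₂, g₂, rfl⟩

theorem isCyclicVector_envSlices [CompleteSpace H] [Nontrivial H]
    {U : HilbertTensor H K →L[ℂ] HilbertTensor H K} {ψ : K}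
    (hψ : Dense (Submodule.span ℂ (ampliationOrbit (dilation U ψ)) : Set (HilbertTensor H K))) :
    IsCyclicVector (envSlices U) ψ := by
  refine isCyclicVector_iff_forall_inner_eq_zero.mpr fun κ hκ => ?_
  obtain ⟨h, hh⟩ := exists_ne (0 : H)
  have pureTensor_eq_zero : pureTensor h κ = 0 := by
    refine dense_span_iff_forall_inner_eq_zero.mp hψ _ ?_
    rintro _ ⟨X, f, rfl⟩
    rw [inner_pureTensor_ampliation]
    exact (inner_envPartialTrace U _ f κ ψ).symm.trans (hκ _ ⟨_, f, rfl⟩)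
  simpa [pureTensor_eq_zero, hh] using inner_pureTensor h h κ κ

end Slices

end EnvAction

theorem corollary3p9_general {H K : Type*}
    [NormedAddCommGroup H] [InnerProductSpace ℂ H] [CompleteSpace H] [Nontrivial H]
    [NormedAddCommGroup K] [InnerProductSpace ℂ K] [CompleteSpace K]
    (U : EnvAction.HilbertTensor H K →L[ℂ] EnvAction.HilbertTensor H K)
    (htotal : ∀ ψ : K, ‖ψ‖ = 1 →
      Dense (Submodule.span ℂ (EnvAction.ampliationOrbit (EnvAction.dilation U ψ)) :
        Set (EnvAction.HilbertTensor H K))) :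
    (EnvAction.rightActionAlgebra U : Set (K →L[ℂ] K)) = Set.univ := by
  have slices_cyclic : ∀ χ ≠ 0, EnvAction.IsCyclicVector (EnvAction.envSlices U) χ := fun χ hχ =>
    (EnvAction.isCyclicVector_envSlices (htotal _ (norm_smul_inv_norm (𝕜 := ℂ) hχ))).of_smul
  have generators_cyclic :
      ∀ χ ≠ 0, EnvAction.IsCyclicVector (EnvAction.rightActionGenerators U) χ := fun χ hχ =>
    EnvAction.star_envSlices_mul_envSlices U ▸
      EnvAction.isCyclicVector_star_mul_self slices_cyclic hχ
  exact EnvAction.centralizer_centralizer_eq_univ generators_cyclic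
    (EnvAction.star_rightActionGenerators U)

theorem corollary3p9 {H K : Type*}
    [NormedAddCommGroup H] [InnerProductSpace ℂ H] [CompleteSpace H] [Nontrivial H]
    [NormedAddCommGroup K] [InnerProductSpace ℂ K] [CompleteSpace K]
    (U : EnvAction.HilbertTensor H K →L[ℂ] EnvAction.HilbertTensor H K)
    (hU : U ∈ unitary (EnvAction.HilbertTensor H K →L[ℂ] EnvAction.HilbertTensor H K))
    (hmin : ∀ ψ : K, ‖ψ‖ = 1 →
      EnvAction.IsMinimalStinespring (EnvAction.reducedMap U ψ) (EnvAction.dilation U ψ)) :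
    (EnvAction.rightActionAlgebra U : Set (K →L[ℂ] K)) = Set.univ :=
  corollary3p9_general U fun ψ hψ =>
    Submodule.dense_iff_topologicalClosure_eq_top.mpr (hmin ψ hψ).2
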